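/- **Theorem 2.** Let $M\subset{\bf P}^m$ be a complex projective variety and let $f:{\bf C}\to M$ be a holomorphic map. Let $F=(f_0,\dots,f_m)$ be a homogeneous representation of $f$, that is, $f=(f_0:\dots:f_m)$ with entire functions $f_0,\dots,f_m$ without common zeros, and let $\mu$ be the Riesz measure of the subharmonic function $u=\log\|F\|=\frac12\log(|f_0|^2+\dots+|f_m|^2)$, that is, $\mu=\frac1{2\pi}\Delta u$ in the sense of distributions. Suppose that $$\limsup_{k\to\infty}\mu(\{z\in{\bf C}:2^k\le|z|\le 2^{k+1}\})=\infty .$$ Then $f$ has at least one Julia direction. In other words, there is $\theta\in[0,2\pi)$ with the following property: for every integer $n\ge 0$, every finite system $D_1,\dots,D_q$ of divisors on $M$ (a divisor on $M$ being the intersection of $M$ with a hyperplane of ${\bf P}^m$) such that any $n+1$ of them have empty intersection, and every $\varepsilon>0$, all but at most $2n$ of the divisors $D_1,\dots,D_q$ have infinitely many preimages under $f$ in the sector $\{z:|\arg z-\theta|<\varepsilon\}$, where $\arg z$ is understood modulo $2\pi$. -/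

import Mathlib

namespace HolCurve

/-- Coordinate space `ℂ^{m+1}` with its Hermitian (Euclidean) norm. -/
abbrev Coord (m : ℕ) : Type := EuclideanSpace ℂ (Fin (m + 1))

/-- Complex projective space of dimension `m`. -/
abbrev ProjSpace (m : ℕ) : Type := Projectivization ℂ (Coord m)

/-- `M` is a projective variety: the zero locus in projective space of some set of homogeneous
polynomials (irreducibility is not required). -/
def IsProjectiveVariety {m : ℕ} (M : Set (ProjSpace m)) : Prop :=
  ∃ S : Set (MvPolynomial (Fin (m + 1)) ℂ),
    (∀ p ∈ S, ∃ d : ℕ, p.IsHomogeneous d) ∧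
    ∀ (v : Coord m) (hv : v ≠ 0),
      Projectivization.mk ℂ v hv ∈ M ↔ ∀ p ∈ S, MvPolynomial.eval (fun i => v i) p = 0

/-- `H` is a hyperplane: the zero locus of a nonzero linear form. -/
def IsHyperplane {m : ℕ} (H : Set (ProjSpace m)) : Prop :=
  ∃ L : Coord m →ₗ[ℂ] ℂ, L ≠ 0 ∧
    ∀ (v : Coord m) (hv : v ≠ 0), Projectivization.mk ℂ v hv ∈ H ↔ L v = 0

/-- A divisor on `M` is the intersection of a hyperplane with `M`. -/
def IsDivisor {m : ℕ} (M D : Set (ProjSpace m)) : Prop :=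
  ∃ H : Set (ProjSpace m), IsHyperplane H ∧ D = H ∩ M

/-- A map from the plane to projective space is holomorphic if near each point it is given in
homogeneous coordinates by a zero-free holomorphic vector function. -/
def IsHolomorphic {m : ℕ} (f : ℂ → ProjSpace m) : Prop :=
  ∀ z₀ : ℂ, ∃ U : Set ℂ, IsOpen U ∧ z₀ ∈ U ∧ ∃ G : ℂ → Coord m,
    DifferentiableOn ℂ G U ∧ ∀ z ∈ U, ∃ hz : G z ≠ 0, f z = Projectivization.mk ℂ (G z) hz

/-- `F = (f_0, …, f_m)` is a homogeneous representation of `f`: the `f_j` are entire functions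
without common zeros and `f = (f_0 : … : f_m)`. -/
def IsHomogeneousRepresentation {m : ℕ} (F : ℂ → Coord m) (f : ℂ → ProjSpace m) : Prop :=
  (∀ j : Fin (m + 1), Differentiable ℂ (fun z => F z j)) ∧
  ∀ z : ℂ, ∃ hz : F z ≠ 0, f z = Projectivization.mk ℂ (F z) hz

/-- `μ` is the Riesz measure of `u`: the locally finite Borel measure that equals `(1 / 2π) Δu`
in the sense of distributions. -/
def IsRieszMeasure (u : ℂ → ℝ) (μ : MeasureTheory.Measure ℂ) : Prop :=
  MeasureTheory.LocallyIntegrable u MeasureTheory.volume ∧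
  MeasureTheory.IsLocallyFiniteMeasure μ ∧
  ∀ φ : ℂ → ℝ, ContDiff ℝ (⊤ : ℕ∞) φ → HasCompactSupport φ →
    ∫ z, φ z ∂μ = (1 / (2 * Real.pi)) * ∫ z, u z * Laplacian.laplacian φ z

/-- The closed dyadic annulus `2^k ≤ |z| ≤ 2^(k+1)`. -/
def dyadicAnnulus (k : ℕ) : Set ℂ :=
  {z : ℂ | (2 : ℝ) ^ k ≤ ‖z‖ ∧ ‖z‖ ≤ (2 : ℝ) ^ (k + 1)}

/-- The sector `|arg z - θ| < ε`: the nonzero `z` that have some argument `t` (arguments are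
determined modulo `2π`) with `|t - θ| < ε`. -/
def sector (θ ε : ℝ) : Set ℂ :=
  {z : ℂ | ∃ r t : ℝ, 0 < r ∧ |t - θ| < ε ∧ z = (r : ℂ) * Complex.exp ((t : ℂ) * Complex.I)}

/-- `θ` is a Julia direction for the curve `f` with values in `M`: for every `n`, every finite
system of divisors on `M` any `n + 1` of which have empty intersection, and every `ε > 0`, all
but at most `2n` of these divisors have infinitely many preimages in `|arg z - θ| < ε`. -/
def IsJuliaDirection {m : ℕ} (M : Set (ProjSpace m)) (f : ℂ → ProjSpace m) (θ : ℝ) : Prop :=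
  ∀ (n q : ℕ) (D : Fin q → Set (ProjSpace m)),
    (∀ j, IsDivisor M (D j)) →
    (∀ I : Finset (Fin q), I.card = n + 1 → ⋂ j ∈ I, D j = ∅) →
    ∀ ε : ℝ, 0 < ε →
      Set.ncard {j : Fin q | ¬ (f ⁻¹' D j ∩ sector θ ε).Infinite} ≤ 2 * n

end HolCurve

/-!
The proof is by contradiction, and reduces the existence of a Julia direction to a Schottky type
theorem for tuples of zero-free holomorphic functions.

**The Schottky theorem** (`schottky`). Let `G = (G_j)` be a tuple of at most `2n + 1` zero-free
holomorphic functions on a disc, such that at each point at least `n + 1` of the `‖G_j‖` are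
comparable, with a constant `c`, to the maximum norm `‖G‖`. Then on a smaller concentric disc one
and the same `‖G_j‖` is comparable to `‖G‖`, with a constant `A` that depends on `n` and `c` only.
Three ingredients carry the proof.

* *Rigidity* (`exists_forall_norm_apply_eq`). If at each point at least `n + 1` of the `‖E_j‖` are
  equal to `‖E‖`, then one index works everywhere: around a point where the set of maximal indices
  is smallest this set is constant, so that by the maximum principle the functions in it are
  proportional; and any two sets of `n + 1` among `2n + 1` indices meet.
* *Local comparability implies global comparability* (`exists_local_to_global`). Suppose that every
  disc of half the size carries an index comparable to `‖G‖` with constant `A`. By Harnack's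
  inequality along chains of discs, some `G_i` is comparable to `‖G‖` with constant `A ^ K`, for a
  universal `K`. The functions `(G_j / G_i) ^ (1 / log A)` are therefore bounded independently of
  `A`, while the constant `c` becomes `c ^ (1 / log A)`. In the limit `A → ∞` they satisfy the
  hypothesis of rigidity, which gives one index with constant `A` on the unit disc, once `A` is
  large.
* *Descent*. If no index is comparable to `‖G‖` on a disc, then the same holds, with the same `A`,
  on some disc of half the size nearby, and so on; at a limit point of these discs this
  contradicts continuity.

**The Riesz measure.** Suppose that no direction is a Julia direction. Then each point `ζ ≠ 0` lies
in a sector where `2n + 1` of the functions `L_j ∘ F` have finitely many zeros, `L_j = 0` being the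
hyperplanes that cut out divisors any `n + 1` of which have no common point. As the unit vectors
over `M` form a compact set, the tuple `(L_j ∘ F)` satisfies the hypothesis of the Schottky theorem
on the discs `2 ^ k • ball ζ r` for all large `k`. Hence there `log ‖F‖` is at bounded distance from
the harmonic function `log ‖L_j ∘ F‖`, with a bound independent of `k`. Testing the Riesz measure
against rescaled bump functions bounds the mass of smaller concentric discs
(`exists_measure_ball_le`). Finitely many of them cover the annulus `1 ≤ ‖ζ‖ ≤ 2`, so the masses of
the dyadic annuli are eventually bounded.
-/

namespace HolCurve

section

open Filter Topology Metric MeasureTheory Laplacian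

variable {ι : Type*} [Fintype ι]

/-! ### Rigidity of tuples with many maximal components -/

theorem exists_mem_inter_of_card_le {n : ℕ} (hι : Fintype.card ι ≤ 2 * n + 1) {s t : Set ι}
    (hs : n + 1 ≤ s.ncard) (ht : n + 1 ≤ t.ncard) : ∃ j, j ∈ s ∧ j ∈ t := by
  by_contra! h
  have hd : Disjoint s t := Set.disjoint_left.2 h
  have h1 := Set.ncard_union_eq hd (Set.toFinite _) (Set.toFinite _)
  have h2 : (s ∪ t).ncard ≤ Fintype.card ι := by
    rw [← Nat.card_eq_fintype_card]
    exact Set.ncard_le_card _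
  omega

/-- If at each point of a domain more than half of the components of a nowhere vanishing holomorphic
tuple have maximal modulus, then some component has maximal modulus everywhere. -/
theorem exists_forall_norm_apply_eq {n : ℕ} (hι : Fintype.card ι ≤ 2 * n + 1) {U : Set ℂ}
    (hU : IsOpen U) (hUc : IsPreconnected U) (hne : U.Nonempty) {E : ℂ → ι → ℂ}
    (hd : DifferentiableOn ℂ E U) (h0 : ∀ z ∈ U, E z ≠ 0)
    (hs : ∀ z ∈ U, n + 1 ≤ {j | ‖E z j‖ = ‖E z‖}.ncard) :
    ∃ j, ∀ z ∈ U, ‖E z j‖ = ‖E z‖ := by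
  obtain ⟨z₀, hz₀, hmin⟩ : ∃ z₀ ∈ U, ∀ z ∈ U,
      {j | ‖E z₀ j‖ = ‖E z₀‖}.ncard ≤ {j | ‖E z j‖ = ‖E z‖}.ncard := by
    have := WellFounded.has_min (wellFounded_lt (α := ℕ))
      ((fun z => {j | ‖E z j‖ = ‖E z‖}.ncard) '' U) (hne.image _)
    obtain ⟨_, ⟨z₀, hz₀, rfl⟩, h⟩ := this
    exact ⟨z₀, hz₀, fun z hz => not_lt.1 (h _ ⟨z, hz, rfl⟩)⟩
  have hUn : U ∈ 𝓝 z₀ := hU.mem_nhds hz₀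
  have hdj : ∀ j, DifferentiableOn ℂ (fun z => E z j) U := fun j => differentiableOn_pi.1 hd j
  have hc : ContinuousAt E z₀ := hd.continuousOn.continuousAt hUn
  -- Near any point the set of maximal indices can only shrink; at `z₀` it is already smallest.
  have hev : ∀ᶠ z in 𝓝 z₀, {j | ‖E z j‖ = ‖E z‖} = {j | ‖E z₀ j‖ = ‖E z₀‖} := by
    have h1 : ∀ᶠ z in 𝓝 z₀, ∀ j, ‖E z j‖ = ‖E z‖ → ‖E z₀ j‖ = ‖E z₀‖ := by
      rw [eventually_all]
      intro j
      by_cases hj : ‖E z₀ j‖ = ‖E z₀‖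
      · simp [hj]
      · have hlt : ‖E z₀ j‖ < ‖E z₀‖ := lt_of_le_of_ne (norm_le_pi_norm _ _) hj
        have hcj : ContinuousAt (fun z => ‖E z j‖) z₀ :=
          ((hdj j).continuousOn.continuousAt hUn).norm
        filter_upwards [hcj.eventually_lt hc.norm hlt] with z hz h
        exact absurd h hz.ne
    filter_upwards [h1, hUn] with z hz hzU
    exact Set.eq_of_subset_of_ncard_le (fun j hj => hz j hj) (hmin z hzU) (Set.toFinite _)
  obtain ⟨i, hi, -⟩ := exists_mem_inter_of_card_le hι (hs z₀ hz₀) (hs z₀ hz₀)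
  have hi0 : ∀ z, z ∈ U → ‖E z i‖ = ‖E z‖ → E z i ≠ 0 := fun z hz h h' => by
    rw [h', norm_zero] at h
    exact h0 z hz (norm_eq_zero.1 h.symm)
  -- The quotient of two maximal components has modulus one near `z₀`, hence is constant there, and
  -- the identity theorem propagates the proportionality to `U`.
  have key : ∀ j, ‖E z₀ j‖ = ‖E z₀‖ → ∀ z ∈ U, ‖E z j‖ = ‖E z i‖ := by
    intro j hj
    set q : ℂ → ℂ := fun z => E z j / E z i with hq
    have hnorm : ∀ᶠ z in 𝓝 z₀, ‖q z‖ = 1 ∧ z ∈ U ∧ E z i ≠ 0 := by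
      filter_upwards [hev, hUn] with z hz hzU
      have h1 : ‖E z i‖ = ‖E z‖ := by
        have : i ∈ {j | ‖E z j‖ = ‖E z‖} := by rw [hz]; exact hi
        exact this
      have h2 : ‖E z j‖ = ‖E z‖ := by
        have : j ∈ {j | ‖E z j‖ = ‖E z‖} := by rw [hz]; exact hj
        exact this
      refine ⟨?_, hzU, hi0 z hzU h1⟩
      rw [hq, norm_div, h1, h2, div_self]
      exact norm_ne_zero_iff.2 (h0 z hzU)
    have hqd : ∀ᶠ z in 𝓝 z₀, DifferentiableAt ℂ q z := by
      filter_upwards [hnorm] with z hz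
      exact ((hdj j).differentiableAt (hU.mem_nhds hz.2.1)).div
        ((hdj i).differentiableAt (hU.mem_nhds hz.2.1)) hz.2.2
    have hq0 : ‖q z₀‖ = 1 := hnorm.self_of_nhds.1
    have hmax : IsLocalMax (norm ∘ q) z₀ := by
      filter_upwards [hnorm] with z hz
      simp [hz.1, hq0]
    have hconst := Complex.eventually_eq_of_isLocalMax_norm hqd hmax
    have heq : (fun z => E z j) =ᶠ[𝓝 z₀] fun z => q z₀ * E z i := by
      filter_upwards [hconst, hnorm] with z hz hz'
      rw [← hz, hq]
      exact (div_mul_cancel₀ _ hz'.2.2).symm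
    have := AnalyticOnNhd.eqOn_of_preconnected_of_eventuallyEq ((hdj j).analyticOnNhd hU)
      (((hdj i).const_mul (q z₀)).analyticOnNhd hU) hUc hz₀ heq
    intro z hz
    have h := this hz
    simp only at h
    rw [h, norm_mul, hq0, one_mul]
  refine ⟨i, fun z hz => ?_⟩
  obtain ⟨j, hj, hj'⟩ := exists_mem_inter_of_card_le hι (hs z₀ hz₀) (hs z hz)
  rw [← key j hj z hz, hj']

/-! ### Limits of bounded sequences -/

/-- Montel's theorem along an ultrafilter: a uniformly bounded sequence of holomorphic functions on
a disc converges locally uniformly along any ultrafilter. -/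
theorem exists_tendstoLocallyUniformlyOn_of_bounded {F : Type*} [NormedAddCommGroup F]
    [NormedSpace ℂ F] [ProperSpace F] (𝒰 : Ultrafilter ℕ) {E : ℕ → ℂ → F} {a : ℂ} {R B : ℝ}
    (hd : ∀ k, DifferentiableOn ℂ (E k) (ball a R)) (hB : ∀ k, ∀ z ∈ ball a R, ‖E k z‖ ≤ B) :
    ∃ E' : ℂ → F, TendstoLocallyUniformlyOn E E' (𝒰 : Filter ℕ) (ball a R) := by
  have hlim : ∀ z, ∃ L, z ∈ ball a R → Tendsto (fun k => E k z) 𝒰 (𝓝 L) := by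
    intro z
    by_cases hz : z ∈ ball a R
    · obtain ⟨L, -, hL⟩ := (isCompact_closedBall (0 : F) B).ultrafilter_le_nhds
        (𝒰.map fun k => E k z) (by
          rw [le_principal_iff]
          exact Ultrafilter.mem_map.2 (univ_mem' fun k => by simpa using hB k z hz))
      exact ⟨L, fun _ => hL⟩
    · exact ⟨0, fun h => absurd h hz⟩
  choose E' hE' using hlim
  refine ⟨E', Metric.tendstoLocallyUniformlyOn_iff.2 fun ε hε x hx => ?_⟩
  have hB0 : 0 ≤ B := (norm_nonneg _).trans (hB 0 x hx)
  obtain ⟨r, hr, hrR⟩ : ∃ r, 0 < r ∧ ball x r ⊆ ball a R := Metric.isOpen_iff.1 isOpen_ball x hx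
  -- The Schwarz lemma gives a Lipschitz bound at `x` that is uniform in `k`.
  have hLip : ∀ k, ∀ y ∈ ball x r, dist (E k y) (E k x) ≤ (2 * B + 1) / r * dist y x := by
    intro k y hy
    refine Complex.dist_le_div_mul_dist_of_mapsTo_ball ((hd k).mono hrR) (fun w hw => ?_) hy
    have h1 := hB k w (hrR hw)
    have h2 := hB k x hx
    have : dist (E k w) (E k x) ≤ ‖E k w‖ + ‖E k x‖ := by
      rw [dist_eq_norm]; exact norm_sub_le _ _
    rw [mem_closedBall]
    linarith
  set δ := min r (ε / 4 / ((2 * B + 1) / r)) with hδ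
  have hδ0 : 0 < δ := by positivity
  have hK : 0 < (2 * B + 1) / r := by positivity
  have hsmall : ∀ k, ∀ y ∈ ball x δ, dist (E k y) (E k x) ≤ ε / 4 := by
    intro k y hy
    have hy' : dist y x < δ := hy
    refine (hLip k y (ball_subset_ball (min_le_left _ _) hy)).trans ?_
    have : dist y x ≤ ε / 4 / ((2 * B + 1) / r) := hy'.le.trans (min_le_right _ _)
    rw [le_div_iff₀ hK] at this
    linarith [mul_comm (dist y x) ((2 * B + 1) / r)]
  have hδR : ball x δ ⊆ ball a R := (ball_subset_ball (min_le_left _ _)).trans hrR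
  refine ⟨ball x δ, mem_nhdsWithin_of_mem_nhds (ball_mem_nhds x hδ0), ?_⟩
  filter_upwards [(Metric.tendsto_nhds.1 (hE' x hx)) (ε / 4) (by positivity)] with k hk y hy
  have h3 : dist (E' y) (E' x) ≤ ε / 4 :=
    le_of_tendsto ((hE' y (hδR hy)).dist (hE' x hx))
      (Filter.Eventually.of_forall fun k => hsmall k y hy)
  have h4 := hsmall k y hy
  have h5 := dist_triangle4 (E' y) (E' x) (E k x) (E k y)
  rw [dist_comm] at hk
  rw [dist_comm (E k x) (E k y)] at h5
  linarith

/-- Asymptotic form of the rigidity theorem: if the proportion `η k` by which the `n + 1` largest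
components are comparable to the maximum tends to `1`, then for some `k` one component is
comparable to the maximum on a smaller disc. -/
theorem exists_forall_norm_lt_of_spread {n : ℕ} (hι : Fintype.card ι ≤ 2 * n + 1)
    {E : ℕ → ℂ → ι → ℂ} {B : ℝ} {η : ℕ → ℝ} (hη : Tendsto η atTop (𝓝 1))
    (hd : ∀ k, DifferentiableOn ℂ (E k) (ball 0 2)) (hB : ∀ k, ∀ z ∈ ball 0 2, ‖E k z‖ ≤ B)
    (h1 : ∀ k, ∀ z ∈ ball 0 2, 1 ≤ ‖E k z‖)
    (hs : ∀ k, ∀ z ∈ ball 0 2, n + 1 ≤ {j | η k * ‖E k z‖ ≤ ‖E k z j‖}.ncard) :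
    ∃ k j, ∀ z ∈ ball 0 1, ‖E k z‖ < 2 * ‖E k z j‖ := by
  by_contra! hcon
  choose w hw hwle using hcon
  set 𝒰 : Ultrafilter ℕ := hyperfilter ℕ with h𝒰
  have hU : (𝒰 : Filter ℕ) ≤ atTop := Nat.hyperfilter_le_atTop
  obtain ⟨E', hE'⟩ := exists_tendstoLocallyUniformlyOn_of_bounded 𝒰 hd hB
  have hd' : DifferentiableOn ℂ E' (ball 0 2) :=
    hE'.differentiableOn (Filter.Eventually.of_forall hd) isOpen_ball
  have hpt : ∀ z ∈ ball (0 : ℂ) 2, Tendsto (fun k => E k z) 𝒰 (𝓝 (E' z)) := fun z hz =>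
    hE'.tendsto_at hz
  have h1' : ∀ z ∈ ball (0 : ℂ) 2, 1 ≤ ‖E' z‖ := fun z hz =>
    ge_of_tendsto (hpt z hz).norm (Filter.Eventually.of_forall fun k => h1 k z hz)
  obtain ⟨j, hj⟩ := exists_forall_norm_apply_eq hι (isOpen_ball (x := (0 : ℂ)) (ε := 2))
    (convex_ball _ _).isPreconnected ⟨0, by simp⟩ hd'
    (fun z hz h => by have := h1' z hz; rw [h, norm_zero] at this; linarith) (by
      intro z hz
      have hsub : ∀ᶠ k in (𝒰 : Filter ℕ), ∀ j, η k * ‖E k z‖ ≤ ‖E k z j‖ →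
          ‖E' z j‖ = ‖E' z‖ := by
        rw [eventually_all]
        intro j
        by_cases hj : ∀ᶠ k in (𝒰 : Filter ℕ), η k * ‖E k z‖ ≤ ‖E k z j‖
        · refine Filter.Eventually.of_forall fun k _ => le_antisymm (norm_le_pi_norm _ _) ?_
          have hl := ((hη.mono_left hU).mul (hpt z hz).norm)
          rw [one_mul] at hl
          exact le_of_tendsto_of_tendsto hl ((tendsto_pi_nhds.1 (hpt z hz) j).norm) hj
        · filter_upwards [Ultrafilter.eventually_not.2 hj] with k hk h
          exact absurd h hk
      obtain ⟨k, hk⟩ := hsub.exists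
      exact (hs k z hz).trans (Set.ncard_le_ncard (fun j hj => hk j hj) (Set.toFinite _)))
  obtain ⟨x, hx, hxlim⟩ := (isCompact_closedBall (0 : ℂ) 1).ultrafilter_le_nhds
    (𝒰.map fun k => w k j) (by
      rw [le_principal_iff]
      exact Ultrafilter.mem_map.2 (univ_mem' fun k => ball_subset_closedBall (hw k j)))
  have hx2 : x ∈ ball (0 : ℂ) 2 := closedBall_subset_ball (by norm_num) hx
  have hlim : Tendsto (fun k => E k (w k j)) 𝒰 (𝓝 (E' x)) := by
    refine hE'.tendsto_comp (hd'.continuousOn x hx2) hx2 ?_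
    rw [isOpen_ball.nhdsWithin_eq hx2]
    exact hxlim
  have hle : 2 * ‖E' x j‖ ≤ ‖E' x‖ :=
    le_of_tendsto_of_tendsto (((tendsto_pi_nhds.1 hlim j).norm).const_mul 2) hlim.norm
      (Filter.Eventually.of_forall fun k => hwle k j)
  rw [hj x hx2] at hle
  linarith [h1' x hx2]

/-! ### Harnack's inequality and chains of discs -/

theorem harnack {p : ℂ → ℝ} {c w : ℂ} {R : ℝ}
    (hp : InnerProductSpace.HarmonicOnNhd p (closedBall c R)) (hp0 : ∀ z ∈ closedBall c R, 0 ≤ p z)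
    (hw : w ∈ ball c R) : p w ≤ (R + ‖w - c‖) / (R - ‖w - c‖) * p c := by
  have hR : 0 < R := pos_of_mem_ball hw
  have hcont : ContinuousOn p (sphere c |R|) := fun z hz => by
    rw [abs_of_pos hR] at hz
    exact (hp z (sphere_subset_closedBall hz)).1.continuousAt.continuousWithinAt
  have hi : CircleIntegrable p c R := hcont.circleIntegrable'
  have h1 := hp.circleAverage_re_herglotzRieszKernel_smul hw
  have h2 : Real.circleAverage p c R = p c := by
    refine InnerProductSpace.HarmonicOnNhd.circleAverage_eq ?_
    rwa [abs_of_pos hR]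
  rw [← h1, ← h2, ← smul_eq_mul, ← Real.circleAverage_fun_smul]
  refine Real.circleAverage_mono ?_ ?_ ?_
  · exact ContinuousOn.circleIntegrable' ((Complex.continuous_re.comp_continuousOn
      (continuousOn_herglotzRieszKernel_sphere hw)).smul hcont)
  · exact hi.const_smul
  · intro z hz
    rw [abs_of_pos hR] at hz
    have := re_herglotzRieszKernel_le hz hw
    simp only [Pi.smul_apply', Function.comp_apply, smul_eq_mul]
    exact mul_le_mul_of_nonneg_right this (hp0 z (sphere_subset_closedBall hz))

/-- One step of a chain of discs: the comparison of `‖G‖` with `‖G i‖` at the centre `b` of a disc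
carries over to nearby points, if some other component dominates on that disc. -/
theorem norm_le_exp_mul_of_norm_le {G : ℂ → ι → ℂ} {b w : ℂ} {A x : ℝ} {i j : ι} (hA : 1 ≤ A)
    (hd : DifferentiableOn ℂ G (ball b (1 / 2))) (h0 : ∀ z ∈ ball b (1 / 2), ∀ l, G z l ≠ 0)
    (hj : ∀ z ∈ ball b (1 / 2), ‖G z‖ ≤ A * ‖G z j‖) (hi : ‖G b‖ ≤ Real.exp x * ‖G b i‖)
    (hw : dist w b ≤ 1 / 4) :
    ‖G w‖ ≤ Real.exp (5 * (x + Real.log A)) * ‖G w i‖ := by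
  have hA0 : 0 < A := by linarith
  -- `log ‖Q‖` is a nonnegative harmonic function, to which Harnack's inequality applies.
  set Q : ℂ → ℂ := fun z => A * G z j / G z i with hQ
  have hb : b ∈ ball b (1 / 2) := by simp
  have hwb : w ∈ ball b (1 / 2) := by rw [mem_ball]; linarith
  have hnQ : ∀ z, ‖Q z‖ = A * ‖G z j‖ / ‖G z i‖ := fun z => by
    simp [hQ, abs_of_pos hA0]
  have hpos : ∀ z ∈ ball b (1 / 2), ∀ l, 0 < ‖G z l‖ := fun z hz l => norm_pos_iff.2 (h0 z hz l)
  have hsub : closedBall b (2 / 5) ⊆ ball b (1 / 2) := closedBall_subset_ball (by norm_num)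
  have hdl : ∀ l, DifferentiableOn ℂ (fun z => G z l) (ball b (1 / 2)) := differentiableOn_pi.1 hd
  have hharm : InnerProductSpace.HarmonicOnNhd (fun z => Real.log ‖Q z‖) (closedBall b (2 / 5)) := by
    intro z hz
    have hz' := hsub hz
    refine AnalyticAt.harmonicAt_log_norm ?_ ?_
    · refine DifferentiableOn.analyticAt ?_ (isOpen_ball.mem_nhds hz')
      exact ((hdl j).const_mul _).div (hdl i) fun z hz => h0 z hz i
    · have := hpos z hz'
      rw [← norm_pos_iff, hnQ]
      exact div_pos (mul_pos hA0 (this j)) (this i)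
  have hQ1 : ∀ z ∈ ball b (1 / 2), 1 ≤ ‖Q z‖ := by
    intro z hz
    rw [hnQ, one_le_div (hpos z hz i)]
    exact (norm_le_pi_norm _ _).trans (hj z hz)
  have hH := harnack hharm (fun z hz => Real.log_nonneg (hQ1 z (hsub hz)))
    (w := w) (by rw [mem_ball]; linarith)
  -- Harnack's inequality is used on the disc of radius `2 / 5`, where its constant at distance
  -- `1 / 4` is `13 / 3`.
  have hratio : (2 / 5 + ‖w - b‖) / (2 / 5 - ‖w - b‖) ≤ 5 := by
    rw [← dist_eq_norm, div_le_iff₀ (by linarith)]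
    linarith
  have hQb : Real.log ‖Q b‖ ≤ x + Real.log A := by
    rw [Real.log_le_iff_le_exp (by linarith [hQ1 b hb]), Real.exp_add, Real.exp_log hA0, hnQ,
      div_le_iff₀ (hpos b hb i)]
    have := (norm_le_pi_norm (G b) j).trans hi
    nlinarith
  have hQw : Real.log ‖Q w‖ ≤ 5 * (x + Real.log A) := by
    have h1 := Real.log_nonneg (hQ1 b hb)
    calc _ ≤ _ := hH
      _ ≤ 5 * Real.log ‖Q b‖ := mul_le_mul_of_nonneg_right hratio h1
      _ ≤ _ := by linarith
  rw [Real.log_le_iff_le_exp (by linarith [hQ1 w hwb]), hnQ, div_le_iff₀ (hpos w hwb i)] at hQw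
  exact (hj w hwb).trans hQw

/-- If every disc of radius `1 / 2` has a component dominating with constant `A`, then a single
component dominates on the disc of radius `2` with constant a fixed power of `A`. -/
theorem exists_forall_norm_le_exp_mul {G : ℂ → ι → ℂ} {A : ℝ} (hA : 1 ≤ A)
    (hd : DifferentiableOn ℂ G (ball 0 3)) (h0 : ∀ z ∈ ball 0 3, ∀ l, G z l ≠ 0)
    (hloc : ∀ b ∈ ball (0 : ℂ) 2, ∃ j, ∀ z ∈ ball b (1 / 2), ‖G z‖ ≤ A * ‖G z j‖) :
    ∃ i, ∀ z ∈ ball (0 : ℂ) 2, ‖G z‖ ≤ Real.exp (10 ^ 8 * Real.log A) * ‖G z i‖ := by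
  have hL : 0 ≤ Real.log A := Real.log_nonneg hA
  obtain ⟨i, hi⟩ := hloc 0 (by simp)
  refine ⟨i, fun z hz => ?_⟩
  have hz2 : ‖z‖ < 2 := by simpa using hz
  -- Eight steps of length at most `1 / 4` lead from the origin to `z`.
  have key : ∀ t : ℕ, t ≤ 8 → ‖G ((t / 8 : ℝ) * z)‖ ≤
      Real.exp (10 ^ t * Real.log A) * ‖G ((t / 8 : ℝ) * z) i‖ := by
    intro t
    induction t with
    | zero =>
      intro _
      simpa [Real.exp_log (show 0 < A by linarith)] using hi 0 (by simp)
    | succ t ih =>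
      intro ht
      have ht' : ((t / 8 : ℝ) * z) ∈ ball (0 : ℂ) 2 := by
        rw [mem_ball_zero_iff, norm_mul, Complex.norm_real, Real.norm_of_nonneg (by positivity)]
        have : (t / 8 : ℝ) ≤ 1 := by
          rw [div_le_one (by norm_num)]
          exact_mod_cast (by omega : t ≤ 8)
        nlinarith [norm_nonneg z]
      have hsub : ball ((t / 8 : ℝ) * z) (1 / 2) ⊆ ball (0 : ℂ) 3 := by
        refine ball_subset_ball' ?_
        have := mem_ball.1 ht'
        linarith
      obtain ⟨j, hj⟩ := hloc _ ht'
      have hw : dist (((t + 1 : ℕ) / 8 : ℝ) * z) ((t / 8 : ℝ) * z) ≤ 1 / 4 := by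
        rw [dist_eq_norm, ← sub_mul, ← Complex.ofReal_sub, norm_mul, Complex.norm_real,
          show (((t + 1 : ℕ) : ℝ) / 8 - t / 8) = 1 / 8 by push_cast; ring,
          Real.norm_of_nonneg (by norm_num)]
        linarith
      refine (norm_le_exp_mul_of_norm_le hA (hd.mono hsub) (fun z hz => h0 z (hsub hz)) hj
        (ih (by omega)) hw).trans ?_
      refine mul_le_mul_of_nonneg_right (Real.exp_le_exp.2 ?_) (norm_nonneg _)
      have : (1 : ℝ) ≤ 10 ^ t := one_le_pow₀ (by norm_num)
      rw [pow_succ]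
      nlinarith
  simpa using key 8 le_rfl

/-! ### A Schottky type theorem -/

/-- A zero-free holomorphic function on a disc has holomorphic powers with any real exponent. -/
theorem exists_norm_eq_rpow {q : ℂ → ℂ} {a : ℂ} {R : ℝ} (hd : DifferentiableOn ℂ q (ball a R))
    (h0 : ∀ z ∈ ball a R, q z ≠ 0) (t : ℝ) :
    ∃ e : ℂ → ℂ, DifferentiableOn ℂ e (ball a R) ∧ ∀ z ∈ ball a R, ‖e z‖ = ‖q z‖ ^ t := by
  have hharm : InnerProductSpace.HarmonicOnNhd (fun z => Real.log ‖q z‖) (ball a R) := fun z hz =>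
    AnalyticAt.harmonicAt_log_norm (hd.analyticAt (isOpen_ball.mem_nhds hz)) (h0 z hz)
  obtain ⟨Φ, hΦ, hre⟩ := InnerProductSpace.HarmonicOnNhd.exists_analyticOnNhd_ball_re_eq hharm
  refine ⟨fun z => Complex.exp (t * Φ z), (hΦ.differentiableOn.const_mul _).cexp, fun z hz => ?_⟩
  have := hre hz
  simp only at this
  rw [Complex.norm_exp, Real.rpow_def_of_pos (norm_pos_iff.2 (h0 z hz)), Complex.re_ofReal_mul,
    this, mul_comm]

/-- For a suitable constant `A`, if each disc of radius `1 / 2` has a component dominating with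
constant `A`, then some component dominates on the unit disc with the same constant. -/
theorem exists_local_to_global (ι : Type*) [Fintype ι] {n : ℕ}
    (hι : Fintype.card ι ≤ 2 * n + 1) {c : ℝ} (hc : 0 < c) :
    ∃ A : ℝ, 1 < A ∧ ∀ G : ℂ → ι → ℂ, DifferentiableOn ℂ G (ball 0 3) →
      (∀ z ∈ ball 0 3, ∀ l, G z l ≠ 0) →
      (∀ z ∈ ball 0 3, n + 1 ≤ {j | c * ‖G z‖ ≤ ‖G z j‖}.ncard) →
      (∀ b ∈ ball (0 : ℂ) 2, ∃ j, ∀ z ∈ ball b (1 / 2), ‖G z‖ ≤ A * ‖G z j‖) →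
      ∃ j, ∀ z ∈ ball (0 : ℂ) 1, ‖G z‖ ≤ A * ‖G z j‖ := by
  by_contra! hcon
  have hM : ∀ k : ℕ, (0 : ℝ) < k + 1 := fun k => by positivity
  -- Counterexamples for the constants `A = exp (k + 1)`, so that `log A = k + 1`.
  choose G hd h0 hs hloc hfail using
    fun k : ℕ => hcon (Real.exp (k + 1)) (by simpa using hM k)
  choose i hi using fun k => exists_forall_norm_le_exp_mul
    (by simpa using (hM k).le) (hd k) (h0 k) (hloc k)
  have hpos : ∀ k, ∀ z ∈ ball (0 : ℂ) 3, ∀ l, 0 < ‖G k z l‖ := fun k z hz l =>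
    norm_pos_iff.2 (h0 k z hz l)
  have hdl : ∀ k l, DifferentiableOn ℂ (fun z => G k z l) (ball 0 3) := fun k =>
    differentiableOn_pi.1 (hd k)
  choose e hed he using fun k l => exists_norm_eq_rpow
    ((hdl k l).div (hdl k (i k)) fun z hz => h0 k z hz _)
    (fun z hz => div_ne_zero (h0 k z hz l) (h0 k z hz (i k))) (1 / (k + 1 : ℝ))
  have hsub : ball (0 : ℂ) 2 ⊆ ball 0 3 := ball_subset_ball (by norm_num)
  have hen : ∀ k l, ∀ z ∈ ball (0 : ℂ) 3,
      ‖e k l z‖ = (‖G k z l‖ / ‖G k z (i k)‖) ^ (1 / (k + 1 : ℝ)) := fun k l z hz => by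
    rw [he k l z hz]
    simp only [Pi.div_apply, norm_div]
  have ht : ∀ k : ℕ, (0 : ℝ) < 1 / (k + 1 : ℝ) := fun k => by positivity
  have hη : Tendsto (fun k : ℕ => c ^ (1 / (k + 1 : ℝ))) atTop (𝓝 1) := by
    have := (Real.continuousAt_const_rpow (b := 0) hc.ne').tendsto.comp
      (tendsto_one_div_add_atTop_nhds_zero_nat (𝕜 := ℝ))
    simpa [Function.comp_def] using this
  obtain ⟨k, j, hkj⟩ := exists_forall_norm_lt_of_spread hι (E := fun k z l => e k l z)
    (B := Real.exp (10 ^ 8)) hη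
    (fun k => differentiableOn_pi.2 fun l => (hed k l).mono hsub)
    (by
      intro k z hz
      refine (pi_norm_le_iff_of_nonneg (Real.exp_pos _).le).2 fun l => ?_
      rw [hen k l z (hsub hz)]
      have h1 : ‖G k z l‖ / ‖G k z (i k)‖ ≤ Real.exp (10 ^ 8 * (k + 1)) := by
        rw [div_le_iff₀ (hpos k z (hsub hz) _)]
        have := (norm_le_pi_norm (G k z) l).trans (hi k z hz)
        rwa [Real.log_exp] at this
      refine (Real.rpow_le_rpow (by positivity) h1 (ht k).le).trans ?_
      rw [← Real.exp_mul]
      have := hM k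
      field_simp
      exact le_rfl)
    (by
      intro k z hz
      refine le_trans ?_ (norm_le_pi_norm _ (i k))
      rw [hen k _ z (hsub hz), div_self (hpos k z (hsub hz) _).ne', Real.one_rpow])
    (by
      intro k z hz
      refine (hs k z (hsub hz)).trans (Set.ncard_le_ncard (fun j hj => ?_) (Set.toFinite _))
      have hj' : c * ‖G k z‖ ≤ ‖G k z j‖ := hj
      have hct : 0 < c ^ (1 / (k + 1 : ℝ)) := Real.rpow_pos_of_pos hc _
      change _ * _ ≤ ‖e k j z‖
      rw [mul_comm, ← le_div_iff₀ hct]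
      refine (pi_norm_le_iff_of_nonneg (by positivity)).2 fun l => ?_
      have hp := hpos k z (hsub hz) (i k)
      rw [le_div_iff₀ hct, hen k l z (hsub hz), hen k j z (hsub hz),
        ← Real.mul_rpow (by positivity) hc.le]
      refine Real.rpow_le_rpow (by positivity) ?_ (ht k).le
      rw [div_mul_eq_mul_div]
      refine div_le_div_of_nonneg_right ?_ hp.le
      have := norm_le_pi_norm (G k z) l
      nlinarith)
  obtain ⟨z, hz, hlt⟩ := hfail k j
  have hz3 : z ∈ ball (0 : ℂ) 3 := ball_subset_ball (by norm_num) hz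
  refine absurd hlt (not_lt.2 ?_)
  refine (pi_norm_le_iff_of_nonneg (by positivity)).2 fun l => ?_
  have hp := hpos k z hz3 (i k)
  have h1 : ‖e k l z‖ ≤ Real.exp 1 * ‖e k j z‖ := by
    have h2 := (norm_le_pi_norm (fun l => e k l z) l).trans (hkj z hz).le
    have h3 : (2 : ℝ) ≤ Real.exp 1 := by linarith [Real.add_one_le_exp (1 : ℝ)]
    exact h2.trans (mul_le_mul_of_nonneg_right h3 (norm_nonneg _))
  -- The factor `exp 1` for the roots is the factor `A` for the functions themselves.
  have h4 : Real.exp 1 = (Real.exp (k + 1)) ^ (1 / (k + 1 : ℝ)) := by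
    rw [← Real.exp_mul]
    congr 1
    have := hM k
    field_simp
  rw [hen k l z hz3, hen k j z hz3, h4, ← Real.mul_rpow (by positivity) (by positivity),
    Real.rpow_le_rpow_iff (by positivity) (by positivity) (ht k), mul_div_assoc',
    div_le_div_iff_of_pos_right hp] at h1
  exact h1

/-- A Schottky type theorem: if at each point of a disc at least `n + 1` of at most `2n + 1`
zero-free holomorphic functions are comparable to the largest one, then a single one is comparable
to the largest one on a smaller disc, with a constant independent of the functions. -/
theorem schottky (ι : Type*) [Fintype ι] {n : ℕ}
    (hι : Fintype.card ι ≤ 2 * n + 1) {c : ℝ} (hc : 0 < c) :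
    ∃ A : ℝ, 1 < A ∧ ∀ (a : ℂ) (r : ℝ) (G : ℂ → ι → ℂ), 0 < r → DifferentiableOn ℂ G (ball a r) →
      (∀ z ∈ ball a r, ∀ l, G z l ≠ 0) →
      (∀ z ∈ ball a r, n + 1 ≤ {j | c * ‖G z‖ ≤ ‖G z j‖}.ncard) →
      ∃ j, ∀ z ∈ ball a (r / 8), ‖G z‖ ≤ A * ‖G z j‖ := by
  obtain ⟨A, hA, hstep⟩ := exists_local_to_global ι hι hc
  refine ⟨A, hA, fun a r G hr hd h0 hs => ?_⟩
  by_contra! hfail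
  set s : ℝ := r / 8 with hs_def
  have hs0 : 0 < s := by positivity
  -- Failure at scale `s / 2 ^ k` forces failure at half that scale, at a centre moved by less than
  -- `2 * (s / 2 ^ k)`; the total displacement is at most `4 * s`.
  have hseq : ∀ k : ℕ, ∃ b : ℂ, dist b a ≤ 4 * s - 4 * (s / 2 ^ k) ∧
      ∀ j, ∃ z ∈ ball b (s / 2 ^ k), A * ‖G z j‖ < ‖G z‖ := by
    intro k
    induction k with
    | zero => exact ⟨a, by simp, by simpa using hfail⟩
    | succ k ih =>
      obtain ⟨b, hb, hbf⟩ := ih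
      set σ : ℝ := s / 2 ^ k with hσ
      have hσ0 : 0 < σ := by positivity
      have hσ1 : s / 2 ^ (k + 1) = σ / 2 := by rw [hσ, pow_succ]; field_simp
      rw [hσ1]
      by_contra! hno
      -- The affine map `T` takes the unit disc to the disc of radius `σ` about `b`.
      set T : ℂ → ℂ := fun z => b + σ * z with hT
      have hTd : ∀ z w, dist (T z) (T w) = σ * dist z w := by
        intro z w
        simp only [hT, dist_eq_norm]
        rw [add_sub_add_left_eq_sub, ← mul_sub, norm_mul, Complex.norm_real,
          Real.norm_of_nonneg hσ0.le]
      have hT0 : T 0 = b := by simp [hT]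
      have hTmem : ∀ z, z ∈ ball (0 : ℂ) 3 → T z ∈ ball a r := by
        intro z hz
        have h1 := hTd z 0
        rw [hT0] at h1
        have h2 := dist_triangle (T z) b a
        have h3 : dist z 0 < 3 := hz
        rw [mem_ball]
        nlinarith
      have hTinv : ∀ z, T ((z - b) / σ) = z := by
        intro z
        have : (σ : ℂ) ≠ 0 := by exact_mod_cast hσ0.ne'
        simp only [hT]
        field_simp
        ring
      obtain ⟨j, hj⟩ := hstep (fun z => G (T z))
        (hd.comp (by fun_prop) hTmem)
        (fun z hz => h0 _ (hTmem z hz)) (fun z hz => hs _ (hTmem z hz)) (by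
          intro b' hb'
          have h1 := hTd b' 0
          rw [hT0] at h1
          have h3 : dist b' 0 < 2 := hb'
          obtain ⟨j, hj⟩ := hno (T b') (by
            have h2 := dist_triangle (T b') b a
            nlinarith)
          refine ⟨j, fun z hz => hj (T z) ?_⟩
          rw [mem_ball, hTd]
          have : dist z b' < 1 / 2 := hz
          nlinarith)
      obtain ⟨z, hz, hlt⟩ := hbf j
      have := hj ((z - b) / σ) (by
        have h1 := hTd ((z - b) / σ) 0
        rw [hT0, hTinv] at h1
        have h2 : dist z b < σ := hz
        rw [mem_ball]
        rw [h1] at h2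
        nlinarith)
      simp only [hTinv] at this
      linarith
  choose b hb hbf using hseq
  -- At a limit point `x` of the centres, a component maximal at `x` dominates near `x`.
  obtain ⟨x, hx, φ, hφ, hlim⟩ := (isCompact_closedBall a (4 * s)).tendsto_subseq (x := b)
    (fun k => by
      have : 0 < s / 2 ^ k := by positivity
      rw [mem_closedBall]
      linarith [hb k])
  have hxU : ball a r ∈ 𝓝 x := isOpen_ball.mem_nhds
    (closedBall_subset_ball (by rw [hs_def]; linarith) hx)
  have hxm := mem_of_mem_nhds hxU
  obtain ⟨j, hj⟩ : ∃ j, ‖G x‖ ≤ ‖G x j‖ := by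
    by_contra! h
    have hne : {j | c * ‖G x‖ ≤ ‖G x j‖}.Nonempty := by
      rw [← Set.ncard_pos (Set.toFinite _)]
      have := hs x hxm
      omega
    obtain ⟨j₀, -⟩ := hne
    exact lt_irrefl _ ((pi_norm_lt_iff ((norm_nonneg _).trans_lt (h j₀))).2 h)
  have hlt : ‖G x‖ < A * ‖G x j‖ := by
    have := norm_pos_iff.2 (h0 x hxm j)
    nlinarith
  have hcG : ContinuousAt G x := hd.continuousOn.continuousAt hxU
  have hev := hcG.norm.eventually_lt
    (((continuousAt_pi.1 hcG j).norm).const_mul A) hlt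
  obtain ⟨ρ, hρ, hρs⟩ := Metric.eventually_nhds_iff_ball.1 hev
  have hsm : Tendsto (fun k : ℕ => s / 2 ^ (φ k)) atTop (𝓝 0) := by
    have h1 : Tendsto (fun k : ℕ => s * (1 / 2 : ℝ) ^ k) atTop (𝓝 (s * 0)) :=
      (tendsto_pow_atTop_nhds_zero_of_lt_one (by norm_num) (by norm_num)).const_mul s
    rw [mul_zero] at h1
    refine (h1.comp hφ.tendsto_atTop).congr fun k => ?_
    simp [div_eq_mul_inv]
  obtain ⟨k, hk1, hk2⟩ := ((hsm.eventually_lt_const (show (0 : ℝ) < ρ / 2 by positivity)).and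
    (Metric.tendsto_nhds.1 hlim (ρ / 2) (by positivity))).exists
  obtain ⟨z, hz, hzlt⟩ := hbf (φ k) j
  refine absurd (hρs z ?_) (not_lt.2 hzlt.le)
  have h1 : dist z (b (φ k)) < s / 2 ^ (φ k) := hz
  have h2 : dist (b (φ k)) x < ρ / 2 := hk2
  rw [mem_ball]
  linarith [dist_triangle z (b (φ k)) x]

/-! ### Bounding the Riesz measure of a function close to a harmonic one -/

theorem laplacian_comp_const_smul {ψ : ℂ → ℝ} (hψ : ContDiff ℝ 2 ψ) (t : ℝ) (z : ℂ) :
    Δ (fun w => ψ (t • w)) z = t ^ 2 * Δ ψ (t • z) := by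
  have h : ∀ v : ℂ, iteratedFDeriv ℝ 2 (fun w => ψ (t • w)) z ![v, v] =
      t ^ 2 * iteratedFDeriv ℝ 2 ψ (t • z) ![v, v] := by
    intro v
    have h1 := (t • ContinuousLinearMap.id ℝ ℂ).iteratedFDeriv_comp_right hψ z (i := 2) le_rfl
    have h2 : ψ ∘ (t • ContinuousLinearMap.id ℝ ℂ) = fun w => ψ (t • w) := by
      ext w; simp
    rw [h2] at h1
    rw [h1, ContinuousMultilinearMap.compContinuousLinearMap_apply]
    have h3 := (iteratedFDeriv ℝ 2 ψ (t • z)).map_smul_univ (fun _ => t) ![v, v]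
    simp only [Finset.prod_const, Finset.card_univ, Fintype.card_fin, smul_eq_mul] at h3
    rw [← h3]
    rfl
  rw [InnerProductSpace.laplacian_eq_iteratedFDeriv_complexPlane,
    InnerProductSpace.laplacian_eq_iteratedFDeriv_complexPlane]
  simp only [h]
  ring

theorem laplacian_eq_zero_of_notMem_tsupport {ψ : ℂ → ℝ} {z : ℂ} (hz : z ∉ tsupport ψ) :
    Δ ψ z = 0 := by
  have h : ψ =ᶠ[𝓝 z] fun _ => (0 : ℝ) := notMem_tsupport_iff_eventuallyEq.1 hz
  rw [InnerProductSpace.laplacian_congr_nhds h |>.self_of_nhds, InnerProductSpace.laplacian_const]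
  rfl

theorem continuous_laplacian {ψ : ℂ → ℝ} (hψ : ContDiff ℝ (⊤ : ℕ∞) ψ)
    (hc : HasCompactSupport ψ) : Continuous (Δ ψ) := by
  have h : (Δ ψ) = (Δ (hc.toSchwartzMap hψ) : SchwartzMap ℂ ℝ) := by
    ext z
    exact (SchwartzMap.laplacian_apply (hc.toSchwartzMap hψ) z).symm
  rw [h]
  exact SchwartzMap.continuous _

theorem hasCompactSupport_laplacian {ψ : ℂ → ℝ} (hc : HasCompactSupport ψ) :
    HasCompactSupport (Δ ψ) :=
  HasCompactSupport.intro hc fun _ hz => laplacian_eq_zero_of_notMem_tsupport hz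

/-- A function `h` that is harmonic near the support of a test function `ψ` is orthogonal to `Δ ψ`.
As `h` is arbitrary elsewhere, this is stated for a continuous function `H` that agrees with `h`
around the support, so that the integrand is integrable. -/
theorem exists_continuous_integral_mul_laplacian_eq_zero {h ψ : ℂ → ℝ} {a : ℂ} {r R : ℝ}
    (hr : 0 < r) (hrR : r < R) (hh : InnerProductSpace.HarmonicOnNhd h (ball a R))
    (hψ : ContDiff ℝ (⊤ : ℕ∞) ψ) (hs : tsupport ψ ⊆ closedBall a r) :
    ∃ H : ℂ → ℝ, Continuous H ∧ (∀ z ∈ closedBall a r, H z = h z) ∧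
      ∫ z, H z * Δ ψ z = 0 := by
  have hψc : HasCompactSupport ψ :=
    (isCompact_closedBall a r).of_isClosed_subset (isClosed_tsupport _) hs
  let χ : ContDiffBump a := ⟨r + (R - r) / 3, r + 2 * (R - r) / 3, by linarith, by linarith⟩
  have hχs : tsupport χ ⊆ ball a R := by
    rw [χ.tsupport_eq]
    exact closedBall_subset_ball (show r + 2 * (R - r) / 3 < R by linarith)
  set H : ℂ → ℝ := fun z => χ z * h z with hH
  have hHs : tsupport H ⊆ tsupport χ := tsupport_mul_subset_left
  have hHc : HasCompactSupport H := χ.hasCompactSupport.mul_right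
  have hHd : ContDiff ℝ (⊤ : ℕ∞) H := by
    refine contDiff_iff_contDiffAt.2 fun z => ?_
    by_cases hz : z ∈ tsupport H
    swap
    · exact contDiffAt_const.congr_of_eventuallyEq (notMem_tsupport_iff_eventuallyEq.1 hz)
    exact χ.contDiff.contDiffAt.mul
      (HarmonicAt.analyticAt (hh z (hχs (hHs hz)))).contDiffAt
  have hHev : ∀ z ∈ closedBall a r, H =ᶠ[𝓝 z] h := by
    intro z hz
    have h1 := χ.eventuallyEq_one_of_mem_ball (x := z)
      (closedBall_subset_ball (show r < r + (R - r) / 3 by linarith) hz)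
    filter_upwards [h1] with w hw
    simp [hH, hw]
  refine ⟨H, hHd.continuous, fun z hz => (hHev z hz).self_of_nhds, ?_⟩
  have hparts := SchwartzMap.integral_mul_laplacian_right_eq_left (μ := (volume : Measure ℂ))
    (hHc.toSchwartzMap hHd) (hψc.toSchwartzMap hψ)
  simp only [SchwartzMap.laplacian_apply] at hparts
  change ∫ z, H z * Δ ψ z = ∫ z, Δ H z * ψ z at hparts
  rw [hparts]
  refine integral_eq_zero_of_ae (Filter.Eventually.of_forall fun z => ?_)
  by_cases hz : z ∈ tsupport ψ
  · have h1 : Δ H z = Δ h z := (InnerProductSpace.laplacian_congr_nhds (hHev z (hs hz))).self_of_nhds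
    have h2 : Δ h z = 0 := (hh z (closedBall_subset_ball hrR (hs hz))).2.self_of_nhds
    simp [h1, h2]
  · simp [image_eq_zero_of_notMem_tsupport hz]

/-- If `u` is at distance at most `B` from a harmonic function on a disc, then its Riesz measure on
the concentric disc of half the radius is bounded, uniformly under dilations of the disc. -/
theorem exists_measure_ball_le (a : ℂ) {ρ : ℝ} (hρ : 0 < ρ) (B : ℝ) :
    ∃ C : ℝ, ∀ (u h : ℂ → ℝ) (μ : Measure ℂ) (s : ℝ), IsRieszMeasure u μ → Continuous u → 0 < s →
      InnerProductSpace.HarmonicOnNhd h (ball (s • a) (s * ρ)) →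
      (∀ z ∈ ball (s • a) (s * ρ), |u z - h z| ≤ B) →
      μ (ball (s • a) (s * (ρ / 2))) ≤ ENNReal.ofReal C := by
  let φ : ContDiffBump a := ⟨ρ / 2, 3 / 4 * ρ, by linarith, by linarith⟩
  refine ⟨1 / (2 * Real.pi) * (B * ∫ z, |Δ (φ : ℂ → ℝ) z|), ?_⟩
  intro u h μ s hμ hu hs hh hB
  obtain ⟨-, hfin, hμ⟩ := hμ
  set ψ : ℂ → ℝ := fun z => φ (s⁻¹ • z) with hψ_def
  have hφd : ContDiff ℝ (⊤ : ℕ∞) φ := φ.contDiff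
  have hψd : ContDiff ℝ (⊤ : ℕ∞) ψ := hφd.comp (contDiff_const_smul s⁻¹)
  have hdist : ∀ z, dist z (s • a) = s * dist (s⁻¹ • z) a := by
    intro z
    have : z = s • (s⁻¹ • z) := (smul_inv_smul₀ hs.ne' z).symm
    conv_lhs => rw [this]
    rw [dist_smul₀, Real.norm_of_nonneg hs.le]
  have hψs : tsupport ψ ⊆ closedBall (s • a) (s * (3 / 4 * ρ)) := by
    refine closure_minimal (fun z hz => ?_) isClosed_closedBall
    have h1 : s⁻¹ • z ∈ Function.support φ := hz
    rw [φ.support_eq] at h1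
    have h2 : dist (s⁻¹ • z) a < 3 / 4 * ρ := h1
    rw [mem_closedBall, hdist]
    exact mul_le_mul_of_nonneg_left h2.le hs.le
  have hψc : HasCompactSupport ψ :=
    (isCompact_closedBall _ _).of_isClosed_subset (isClosed_tsupport _) hψs
  have hlt : s * (3 / 4 * ρ) < s * ρ := mul_lt_mul_of_pos_left (by linarith) hs
  obtain ⟨H, hHc, hHh, hH0⟩ := exists_continuous_integral_mul_laplacian_eq_zero
    (by positivity) hlt hh hψd hψs
  have hΔc := continuous_laplacian hψd hψc
  have hΔs := hasCompactSupport_laplacian hψc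
  have hint : ∀ g : ℂ → ℝ, Continuous g → Integrable (fun z => g z * Δ ψ z) volume := fun g hg =>
    (hg.mul hΔc).integrable_of_hasCompactSupport hΔs.mul_left
  have hI1 : ∫ z, u z * Δ ψ z = ∫ z, (u z - H z) * Δ ψ z := by
    simp only [sub_mul]
    rw [integral_sub (hint u hu) (hint H hHc), hH0, sub_zero]
  have hbound : ∀ z, ‖(u z - H z) * Δ ψ z‖ ≤ B * |Δ ψ z| := by
    intro z
    by_cases hz : z ∈ tsupport ψ
    · rw [norm_mul, hHh z (hψs hz)]
      exact mul_le_mul_of_nonneg_right (hB z (closedBall_subset_ball hlt (hψs hz))) (abs_nonneg _)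
    · simp [laplacian_eq_zero_of_notMem_tsupport hz]
  have hI2 : ∫ z, u z * Δ ψ z ≤ B * ∫ z, |Δ ψ z| := by
    rw [hI1, ← integral_const_mul]
    refine (le_abs_self _).trans (norm_integral_le_of_norm_le ?_ (Filter.Eventually.of_forall hbound))
    exact ((hΔc.integrable_of_hasCompactSupport hΔs).abs).const_mul B
  -- In the plane, `∫ |Δ ψ|` is invariant under dilations.
  have hI3 : ∫ z, |Δ ψ z| = ∫ z, |Δ (φ : ℂ → ℝ) z| := by
    have h1 : ∀ z, |Δ ψ z| = s⁻¹ ^ 2 * |Δ (φ : ℂ → ℝ) (s⁻¹ • z)| := fun z => by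
      rw [hψ_def, laplacian_comp_const_smul φ.contDiff, abs_mul,
        abs_of_nonneg (by positivity)]
    simp only [h1]
    rw [integral_const_mul,
      Measure.integral_comp_inv_smul (volume : Measure ℂ) (fun z => |Δ (φ : ℂ → ℝ) z|) s,
      Complex.finrank_real_complex, abs_of_nonneg (by positivity), smul_eq_mul, ← mul_assoc]
    field_simp
  have hψi : Integrable ψ μ := hψd.continuous.integrable_of_hasCompactSupport hψc
  have hI : ∫ z, ψ z ∂μ ≤ 1 / (2 * Real.pi) * (B * ∫ z, |Δ (φ : ℂ → ℝ) z|) := by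
    rw [hμ ψ hψd hψc, ← hI3]
    exact mul_le_mul_of_nonneg_left hI2 (by positivity)
  refine le_trans ?_ (ENNReal.ofReal_le_ofReal hI)
  rw [ofReal_integral_eq_lintegral_ofReal hψi (Filter.Eventually.of_forall fun z => φ.nonneg),
    ← lintegral_indicator_one measurableSet_ball]
  refine lintegral_mono fun z => ?_
  by_cases hz : z ∈ ball (s • a) (s * (ρ / 2))
  · have h1 : s⁻¹ • z ∈ closedBall a φ.rIn := by
      rw [mem_ball, hdist] at hz
      exact (lt_of_mul_lt_mul_left hz hs.le).le
    rw [Set.indicator_of_mem hz]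
    simp only [hψ_def, φ.one_of_mem_closedBall h1, ENNReal.ofReal_one, Pi.one_apply, le_refl]
  · rw [Set.indicator_of_notMem hz]
    exact zero_le

/-! ### Sectors -/

theorem sector_mem_nhds {θ ε : ℝ} {z : ℂ} (hz : z ∈ sector θ ε) : sector θ ε ∈ 𝓝 z := by
  obtain ⟨r, t, hr, ht, rfl⟩ := hz
  set z : ℂ := r * Complex.exp (t * Complex.I) with hz
  have hz0 : z ≠ 0 := mul_ne_zero (by exact_mod_cast hr.ne') (Complex.exp_ne_zero _)
  have hcont : ContinuousAt (fun w : ℂ => |(w / z).arg|) z := by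
    have h1 : ContinuousAt Complex.arg (z / z) := by
      rw [div_self hz0]
      exact Complex.continuousAt_arg Complex.one_mem_slitPlane
    exact (ContinuousAt.comp (f := fun w : ℂ => w / z) h1 (by fun_prop)).abs
  have hlt : |(z / z).arg| < ε - |t - θ| := by
    rw [div_self hz0, Complex.arg_one, abs_zero]
    linarith
  filter_upwards [hcont.eventually_lt_const hlt, isOpen_ne.mem_nhds hz0] with w hw hw0
  refine ⟨r * ‖w / z‖, t + (w / z).arg, mul_pos hr (norm_pos_iff.2 (div_ne_zero hw0 hz0)), ?_, ?_⟩
  · have := abs_add_le (t - θ) (w / z).arg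
    rw [show t + (w / z).arg - θ = (t - θ) + (w / z).arg by ring]
    linarith
  · have h1 := Complex.norm_mul_exp_arg_mul_I (w / z)
    calc w = z * (w / z) := by field_simp
      _ = z * (‖w / z‖ * Complex.exp ((w / z).arg * Complex.I)) := by rw [h1]
      _ = _ := by rw [hz]; push_cast; rw [add_mul, Complex.exp_add]; ring

theorem smul_mem_sector {θ ε s : ℝ} {z : ℂ} (hs : 0 < s) (hz : z ∈ sector θ ε) :
    s • z ∈ sector θ ε := by
  obtain ⟨r, t, hr, ht, rfl⟩ := hz
  refine ⟨s * r, t, mul_pos hs hr, ht, ?_⟩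
  rw [Complex.real_smul]
  push_cast
  ring

theorem exists_mem_Ico_forall_mem_sector {z : ℂ} (hz : z ≠ 0) :
    ∃ θ ∈ Set.Ico (0 : ℝ) (2 * Real.pi), ∀ ε, 0 < ε → z ∈ sector θ ε := by
  have hp := Real.pi_pos
  have h1 := Complex.norm_mul_exp_arg_mul_I z
  rcases le_or_gt 0 z.arg with h | h
  · exact ⟨z.arg, ⟨h, by linarith [Complex.arg_le_pi z]⟩, fun ε hε =>
      ⟨‖z‖, z.arg, norm_pos_iff.2 hz, by simpa using hε, h1.symm⟩⟩
  · refine ⟨z.arg + 2 * Real.pi, ⟨by linarith [Complex.neg_pi_lt_arg z], by linarith⟩,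
      fun ε hε => ⟨‖z‖, z.arg + 2 * Real.pi, norm_pos_iff.2 hz, by simpa using hε, ?_⟩⟩
    push_cast
    rw [add_mul, Complex.exp_add, Complex.exp_two_pi_mul_I, mul_one, h1]

/-! ### Divisors in general position -/

/-- If no point of `M` is a common zero of `n + 1` of the linear forms `L j`, then any `n + 1` of
them have a member that is bounded below on the cone over `M`, by compactness of the set of unit
vectors in this cone. -/
theorem exists_pos_forall_mul_norm_le {m n : ℕ} {ι : Type*} [Fintype ι] {M : Set (ProjSpace m)}
    (hM : IsProjectiveVariety M) (L : ι → Coord m →ₗ[ℂ] ℂ)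
    (hL : ∀ I : Finset ι, I.card = n + 1 → ∀ (v : Coord m) (hv : v ≠ 0),
      Projectivization.mk ℂ v hv ∈ M → ∃ j ∈ I, L j v ≠ 0) :
    ∃ c : ℝ, 0 < c ∧ ∀ I : Finset ι, I.card = n + 1 → ∀ (v : Coord m) (hv : v ≠ 0),
      Projectivization.mk ℂ v hv ∈ M → ∃ j ∈ I, c * ‖v‖ ≤ ‖L j v‖ := by
  obtain ⟨S, -, hS⟩ := hM
  set K : Set (Coord m) := sphere 0 1 ∩ {v | ∀ p ∈ S, MvPolynomial.eval (fun i => v i) p = 0}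
    with hK
  have hKc : IsCompact K := by
    refine (isCompact_sphere _ _).inter_right ?_
    have : {v : Coord m | ∀ p ∈ S, MvPolynomial.eval (fun i => v i) p = 0} =
        ⋂ p ∈ S, {v : Coord m | MvPolynomial.eval (fun i => v i) p = 0} := by
      ext v; simp
    rw [this]
    refine isClosed_biInter fun p _ => isClosed_eq ?_ continuous_const
    exact (MvPolynomial.continuous_eval p).comp (by fun_prop)
  have hLc : ∀ j, Continuous (L j) := fun j => LinearMap.continuous_of_finiteDimensional _
  have hev : ∀ᶠ c in 𝓝[>] (0 : ℝ), ∀ I : Finset ι, I.card = n + 1 → ∀ v ∈ K,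
      ∃ j ∈ I, c ≤ ‖L j v‖ := by
    rw [eventually_all]
    intro I
    by_cases hI : I.card = n + 1
    swap
    · simp [hI]
    obtain ⟨a, ha, haK⟩ := hKc.exists_forall_le' (f := fun v => ∑ j ∈ I, ‖L j v‖) (a := 0)
      (by fun_prop) (by
        intro v hv
        have hv0 : v ≠ 0 := fun h => by simpa [h] using hv.1
        obtain ⟨j, hj, hjv⟩ := hL I hI v hv0 ((hS v hv0).2 hv.2)
        exact Finset.sum_pos' (fun _ _ => norm_nonneg _) ⟨j, hj, norm_pos_iff.2 hjv⟩)
    have hpos : 0 < a / (n + 1) := by positivity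
    filter_upwards [mem_nhdsWithin_of_mem_nhds (Iio_mem_nhds hpos)] with c hc _ v hv
    by_contra! hno
    have h1 : ∑ j ∈ I, ‖L j v‖ ≤ ∑ j ∈ I, c := Finset.sum_le_sum fun j hj => (hno j hj).le
    have h2 := haK v hv
    rw [Finset.sum_const, hI, nsmul_eq_mul] at h1
    have hc' : c < a / (n + 1) := hc
    rw [lt_div_iff₀ (by positivity)] at hc'
    push_cast at h1
    linarith
  obtain ⟨c, hc, hc0⟩ := (hev.and self_mem_nhdsWithin).exists
  refine ⟨c, hc0, fun I hI v hv hvM => ?_⟩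
  have hn : 0 < ‖v‖ := norm_pos_iff.2 hv
  have hn' : ((‖v‖ : ℝ) : ℂ) ≠ 0 := by exact_mod_cast hn.ne'
  set w : Coord m := ((‖v‖ : ℝ) : ℂ)⁻¹ • v with hw
  have hw0 : w ≠ 0 := smul_ne_zero (inv_ne_zero hn') hv
  have hmk : Projectivization.mk ℂ w hw0 = Projectivization.mk ℂ v hv :=
    (Projectivization.mk_eq_mk_iff' ℂ _ _ _ _).2 ⟨_, rfl⟩
  have hwK : w ∈ K := by
    refine ⟨?_, (hS w hw0).1 (hmk ▸ hvM)⟩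
    rw [mem_sphere_zero_iff_norm, hw, norm_smul, norm_inv, Complex.norm_real, norm_norm,
      inv_mul_cancel₀ hn.ne']
  obtain ⟨j, hj, hle⟩ := hc I hI w hwK
  refine ⟨j, hj, ?_⟩
  rw [hw, map_smul, norm_smul, norm_inv, Complex.norm_real, norm_norm, inv_mul_eq_div,
    le_div_iff₀ hn] at hle
  exact hle

/-- A set that meets all `n + 1`-element subsets of a `2n + 1`-element type has at least `n + 1`
elements. -/
theorem le_ncard_of_forall_finset {ι : Type*} [Fintype ι] {n : ℕ} (hι : Fintype.card ι = 2 * n + 1)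
    {s : Set ι} (hs : ∀ I : Finset ι, I.card = n + 1 → ∃ j ∈ I, j ∈ s) : n + 1 ≤ s.ncard := by
  classical
  by_contra! h
  have h1 := Set.ncard_add_ncard_compl s (Set.toFinite _) (Set.toFinite _)
  rw [Nat.card_eq_fintype_card, hι] at h1
  obtain ⟨t, ht, htc⟩ := Set.exists_subset_card_eq (s := sᶜ) (n := n + 1) (by omega)
  obtain ⟨j, hj, hjs⟩ := hs t.toFinite.toFinset (by
    rw [← Set.ncard_eq_toFinset_card t, htc])
  exact ht (t.toFinite.mem_toFinset.1 hj) hjs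

/-! ### Discs in sectors without Julia direction -/

/-- If the curve has finitely many points on each of `2n + 1` divisors in a sector, then the Riesz
measure of the dilations by `2 ^ k` of some disc about a point of the sector is bounded. -/
theorem exists_measure_smul_ball_le {m n : ℕ} {M : Set (ProjSpace m)}
    (hM : IsProjectiveVariety M) {f : ℂ → ProjSpace m} (hfM : ∀ z, f z ∈ M)
    {F : ℂ → Coord m} (hF : IsHomogeneousRepresentation F f) {μ : Measure ℂ}
    (hμ : IsRieszMeasure (fun z => Real.log ‖F z‖) μ)
    {ι : Type*} [Fintype ι] (hι : Fintype.card ι = 2 * n + 1) (D : ι → Set (ProjSpace m))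
    (hD : ∀ j, IsDivisor M (D j)) (hDI : ∀ I : Finset ι, I.card = n + 1 → ⋂ j ∈ I, D j = ∅)
    {θ ε : ℝ} (hfin : ∀ j, (f ⁻¹' D j ∩ sector θ ε).Finite) {ζ : ℂ} (hζ : ζ ∈ sector θ ε) :
    ∃ ρ > 0, ∃ C : ℝ, ∀ᶠ k : ℕ in atTop,
      μ (ball ((2 : ℝ) ^ k • ζ) ((2 : ℝ) ^ k * ρ)) ≤ ENNReal.ofReal C := by
  choose H hH hDH using hD
  choose L hL0 hL using hH
  have hmem : ∀ (v : Coord m) (hv : v ≠ 0), Projectivization.mk ℂ v hv ∈ M → ∀ j,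
      (Projectivization.mk ℂ v hv ∈ D j ↔ L j v = 0) := fun v hv hvM j => by
    rw [hDH j, ← hL j v hv]
    exact ⟨fun h => h.1, fun h => ⟨h, hvM⟩⟩
  have hF0 : ∀ z, F z ≠ 0 := fun z => (hF.2 z).1
  have hfF : ∀ z, f z = Projectivization.mk ℂ (F z) (hF0 z) := fun z => (hF.2 z).2
  obtain ⟨c, hc, hcL⟩ := exists_pos_forall_mul_norm_le (n := n) hM L (by
    intro I hI v hv hvM
    by_contra! hno
    have : Projectivization.mk ℂ v hv ∈ ⋂ j ∈ I, D j :=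
      Set.mem_iInter₂.2 fun j hj => (hmem v hv hvM j).2 (hno j hj)
    rw [hDI I hI] at this
    exact this)
  set T : Coord m →L[ℂ] (ι → ℂ) := ContinuousLinearMap.pi fun j => (L j).toContinuousLinearMap
    with hT
  have hTj : ∀ v j, T v j = L j v := fun v j => rfl
  set C₀ : ℝ := ‖T‖ + 1 with hC₀
  have hC₀0 : 0 < C₀ := by positivity
  have hTle : ∀ v, ‖T v‖ ≤ C₀ * ‖v‖ := fun v =>
    (T.le_opNorm v).trans (mul_le_mul_of_nonneg_right (by linarith) (norm_nonneg _))
  set G : ℂ → ι → ℂ := fun z => T (F z) with hG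
  have hFd : Differentiable ℂ F := differentiable_euclidean.2 hF.1
  have hGd : Differentiable ℂ G := T.differentiable.comp hFd
  have hspread : ∀ z, n + 1 ≤ {j | c / C₀ * ‖G z‖ ≤ ‖G z j‖}.ncard := by
    intro z
    refine le_ncard_of_forall_finset hι fun I hI => ?_
    obtain ⟨j, hj, hle⟩ := hcL I hI (F z) (hF0 z) (hfF z ▸ hfM z)
    refine ⟨j, hj, le_trans ?_ hle⟩
    rw [div_mul_eq_mul_div, div_le_iff₀ hC₀0]
    have := hTle (F z)
    nlinarith
  obtain ⟨A, hA, hsch⟩ := schottky ι hι.le (div_pos hc hC₀0)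
  obtain ⟨r₀, hr₀, hr₀s⟩ := Metric.mem_nhds_iff.1 (sector_mem_nhds hζ)
  have hζ0 : 0 < ‖ζ‖ := by
    obtain ⟨r, t, hr, -, rfl⟩ := hζ
    rw [norm_mul, Complex.norm_exp_ofReal_mul_I, mul_one, Complex.norm_real]
    exact norm_pos_iff.2 hr.ne'
  set r : ℝ := min r₀ (‖ζ‖ / 2) with hr
  have hr0 : 0 < r := by positivity
  obtain ⟨C, hC⟩ := exists_measure_ball_le ζ (show 0 < r / 8 by positivity)
    (|Real.log C₀| + |Real.log A| + |Real.log c|)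
  obtain ⟨R, hR⟩ := (Set.finite_iUnion hfin).isBounded.subset_closedBall 0
  have hpow : Tendsto (fun k : ℕ => (2 : ℝ) ^ k * (‖ζ‖ / 2)) atTop atTop :=
    (tendsto_pow_atTop_atTop_of_one_lt one_lt_two).atTop_mul_const (by positivity)
  refine ⟨r / 8 / 2, by positivity, C, ?_⟩
  filter_upwards [hpow.eventually_gt_atTop R] with k hk
  set s : ℝ := 2 ^ k with hs
  have hs0 : 0 < s := by positivity
  -- The disc lies in the sector and outside the ball containing the finitely many zeros.
  have hGz : ∀ z ∈ ball (s • ζ) (s * r), ∀ j, G z j ≠ 0 := by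
    intro z hz j hzero
    have hz1 : z = s • (s⁻¹ • z) := (smul_inv_smul₀ hs0.ne' z).symm
    have hd : dist (s⁻¹ • z) ζ < r := by
      rw [hz1, mem_ball, dist_smul₀, Real.norm_of_nonneg hs0.le] at hz
      exact lt_of_mul_lt_mul_left hz hs0.le
    have hzs : z ∈ sector θ ε := by
      rw [hz1]
      exact smul_mem_sector hs0 (hr₀s (hd.trans_le (min_le_left _ _)))
    have hzD : z ∈ ⋃ j, f ⁻¹' D j ∩ sector θ ε := by
      refine Set.mem_iUnion.2 ⟨j, ?_, hzs⟩
      rw [Set.mem_preimage, hfF z]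
      exact (hmem _ (hF0 z) (hfF z ▸ hfM z) j).2 hzero
    have h1 : ‖z‖ ≤ R := by simpa using hR hzD
    have h2 : ‖ζ‖ / 2 ≤ ‖s⁻¹ • z‖ := by
      have h3 : dist (s⁻¹ • z) ζ < ‖ζ‖ / 2 := hd.trans_le (min_le_right _ _)
      have h4 := norm_sub_norm_le ζ (s⁻¹ • z)
      rw [dist_comm, dist_eq_norm] at h3
      linarith
    rw [norm_smul, norm_inv, Real.norm_of_nonneg hs0.le, inv_mul_eq_div, le_div_iff₀ hs0] at h2
    linarith
  obtain ⟨j, hj⟩ := hsch (s • ζ) (s * r) G (by positivity) hGd.differentiableOn hGz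
    (fun z _ => hspread z)
  rw [mul_div_assoc] at hj
  have hsub : ball (s • ζ) (s * (r / 8)) ⊆ ball (s • ζ) (s * r) :=
    ball_subset_ball (mul_le_mul_of_nonneg_left (by linarith) hs0.le)
  refine hC _ (fun z => Real.log ‖G z j‖) μ s hμ
    (hFd.continuous.norm.log fun z => norm_ne_zero_iff.2 (hF0 z)) hs0 (fun z hz => ?_)
    (fun z hz => ?_)
  · exact AnalyticAt.harmonicAt_log_norm
      ((differentiable_pi.1 hGd j).analyticAt z) (hGz z (hsub hz) j)
  · have hFz : 0 < ‖F z‖ := norm_pos_iff.2 (hF0 z)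
    have hGj : 0 < ‖G z j‖ := norm_pos_iff.2 (hGz z (hsub hz) j)
    have hA0 : 0 < A := by linarith
    have h1 : Real.log ‖G z j‖ ≤ Real.log C₀ + Real.log ‖F z‖ := by
      rw [← Real.log_mul hC₀0.ne' hFz.ne']
      exact Real.log_le_log hGj ((norm_le_pi_norm _ _).trans (hTle _))
    have h2 : Real.log c + Real.log ‖F z‖ ≤ Real.log A + Real.log ‖G z j‖ := by
      rw [← Real.log_mul hc.ne' hFz.ne', ← Real.log_mul hA0.ne' hGj.ne']
      refine Real.log_le_log (by positivity) ?_
      obtain ⟨I, -, hI⟩ := Finset.exists_subset_card_eq (s := (Finset.univ : Finset ι))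
        (n := n + 1) (by rw [Finset.card_univ, hι]; omega)
      obtain ⟨i, -, hi⟩ := hcL I hI (F z) (hF0 z) (hfF z ▸ hfM z)
      exact (hi.trans (norm_le_pi_norm (G z) i)).trans (hj z hz)
    rw [abs_le]
    have := le_abs_self (Real.log C₀)
    have := le_abs_self (Real.log A)
    have := neg_abs_le (Real.log c)
    have := abs_nonneg (Real.log C₀)
    have := abs_nonneg (Real.log A)
    have := abs_nonneg (Real.log c)
    constructor <;> linarith

theorem exists_measure_smul_ball_le_of_not_isJuliaDirection {m : ℕ} {M : Set (ProjSpace m)}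
    (hM : IsProjectiveVariety M) {f : ℂ → ProjSpace m} (hfM : ∀ z, f z ∈ M)
    {F : ℂ → Coord m} (hF : IsHomogeneousRepresentation F f) {μ : Measure ℂ}
    (hμ : IsRieszMeasure (fun z => Real.log ‖F z‖) μ) {θ : ℝ} (hθ : ¬ IsJuliaDirection M f θ)
    {ζ : ℂ} (hζ : ∀ ε, 0 < ε → ζ ∈ sector θ ε) :
    ∃ ρ > 0, ∃ C : ℝ, ∀ᶠ k : ℕ in atTop,
      μ (ball ((2 : ℝ) ^ k • ζ) ((2 : ℝ) ^ k * ρ)) ≤ ENNReal.ofReal C := by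
  unfold IsJuliaDirection at hθ
  push Not at hθ
  obtain ⟨n, q, D, hD, hDI, ε, hε, hcard⟩ := hθ
  obtain ⟨t, ht, htc⟩ := Set.exists_subset_card_eq (Nat.succ_le_of_lt hcard)
  have : Fintype t := t.toFinite.fintype
  -- Of the more than `2 * n` exceptional divisors exactly `2 * n + 1` are kept.
  refine exists_measure_smul_ball_le (n := n) (ι := t) hM hfM hF hμ ?_ (fun j => D j)
    (fun j => hD j) (fun I hI => ?_) (fun j => ?_) (hζ ε hε)
  · rw [← Nat.card_eq_fintype_card, Nat.card_coe_set_eq, htc]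
  · have := hDI (I.map (Function.Embedding.subtype _)) (by rw [Finset.card_map, hI])
    rw [← this]
    ext x
    simp
  · exact ht j.2

theorem limsup_measure_dyadicAnnulus_lt_top {m : ℕ} {M : Set (ProjSpace m)}
    (hM : IsProjectiveVariety M) {f : ℂ → ProjSpace m} (hfM : ∀ z, f z ∈ M)
    {F : ℂ → Coord m} (hF : IsHomogeneousRepresentation F f) {μ : Measure ℂ}
    (hμ : IsRieszMeasure (fun z => Real.log ‖F z‖) μ)
    (hno : ∀ θ ∈ Set.Ico (0 : ℝ) (2 * Real.pi), ¬ IsJuliaDirection M f θ) :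
    limsup (fun k : ℕ => μ (dyadicAnnulus k)) atTop < ⊤ := by
  have hK : IsCompact (closedBall (0 : ℂ) 2 \ ball 0 1) :=
    (isCompact_closedBall _ _).diff isOpen_ball
  obtain ⟨C, hC, hev⟩ := hK.induction_on
    (p := fun s => ∃ C : ENNReal, C < ⊤ ∧ ∀ᶠ k : ℕ in atTop,
      μ ((fun z => ((2 : ℝ) ^ k)⁻¹ • z) ⁻¹' s) ≤ C)
    ⟨0, by simp, by simp⟩
    (fun s t hst ⟨C, hC, h⟩ => ⟨C, hC, h.mono fun k hk =>
      (measure_mono (Set.preimage_mono hst)).trans hk⟩)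
    (fun s t ⟨C, hC, h⟩ ⟨C', hC', h'⟩ => ⟨C + C', ENNReal.add_lt_top.2 ⟨hC, hC'⟩, by
      filter_upwards [h, h'] with k hk hk'
      rw [Set.preimage_union]
      exact (measure_union_le _ _).trans (add_le_add hk hk')⟩)
    (by
      intro ζ hζ
      have hζ0 : ζ ≠ 0 := fun h => hζ.2 (by simp [h])
      obtain ⟨θ, hθ, hsec⟩ := exists_mem_Ico_forall_mem_sector hζ0
      obtain ⟨ρ, hρ, C, hC⟩ := exists_measure_smul_ball_le_of_not_isJuliaDirection
        hM hfM hF hμ (hno θ hθ) hsec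
      refine ⟨ball ζ ρ, mem_nhdsWithin_of_mem_nhds (ball_mem_nhds ζ hρ), ENNReal.ofReal C,
        ENNReal.ofReal_lt_top, hC.mono fun k hk => (measure_mono fun z hz => ?_).trans hk⟩
      have hs : (0 : ℝ) < 2 ^ k := by positivity
      have h1 : dist (((2 : ℝ) ^ k)⁻¹ • z) ζ < ρ := hz
      rw [mem_ball, ← smul_inv_smul₀ hs.ne' z, dist_smul₀, Real.norm_of_nonneg hs.le]
      exact mul_lt_mul_of_pos_left h1 hs)
  have hle : limsup (fun k : ℕ => μ (dyadicAnnulus k)) atTop ≤ C := by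
    refine limsup_le_of_le (h := hev.mono fun k hk => (measure_mono fun z hz => ?_).trans hk)
    have hs : (0 : ℝ) < 2 ^ k := by positivity
    have h1 : (2 : ℝ) ^ k ≤ ‖z‖ := hz.1
    have h2 : ‖z‖ ≤ 2 ^ (k + 1) := hz.2
    have hn : ‖((2 : ℝ) ^ k)⁻¹ • z‖ = ‖z‖ / 2 ^ k := by
      rw [norm_smul, norm_inv, Real.norm_of_nonneg hs.le, inv_mul_eq_div]
    refine ⟨?_, ?_⟩
    · rw [mem_closedBall_zero_iff, hn, div_le_iff₀ hs]
      rw [pow_succ] at h2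
      linarith
    · rw [mem_ball_zero_iff, hn, not_lt, le_div_iff₀ hs]
      linarith
  exact hle.trans_lt hC

end

end HolCurve

theorem theorem2 (m : ℕ) (M : Set (HolCurve.ProjSpace m)) (hM : HolCurve.IsProjectiveVariety M)
    (f : ℂ → HolCurve.ProjSpace m) (hf : HolCurve.IsHolomorphic f) (hfM : ∀ z : ℂ, f z ∈ M)
    (F : ℂ → HolCurve.Coord m) (hF : HolCurve.IsHomogeneousRepresentation F f)
    (μ : MeasureTheory.Measure ℂ)
    (hμ : HolCurve.IsRieszMeasure (fun z => Real.log ‖F z‖) μ)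
    (hlim : Filter.limsup (fun k : ℕ => μ (HolCurve.dyadicAnnulus k)) Filter.atTop = ⊤) :
    ∃ θ ∈ Set.Ico (0 : ℝ) (2 * Real.pi), HolCurve.IsJuliaDirection M f θ := by
  by_contra! hno
  exact (HolCurve.limsup_measure_dyadicAnnulus_lt_top hM hfM hF hμ hno).ne hlim
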